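/- Let $G$ be a finite simple graph with vertex set $V$ that is unicyclic (connected and containing exactly one cycle) and not bipartite, and let the length of its unique cycle be $2k-1$. Let $K$ be a field, $R = K[x_v \mid v \in V]$, $\mathfrak m = (x_v \mid v\in V)$, and let $I(G) = (x_i x_j \mid \{i,j\} \in E(G)) \subseteq R$ be the edge ideal of $G$. For a nonzero finitely generated graded $R$-module $M$, $\operatorname{depth} M$ denotes the maximal length of an $M$-regular sequence in $\mathfrak m$; for a homogeneous ideal $I$ of $R$ put $$\operatorname{dstab}(I) := \min\{n_0 \geqslant 1 \mid \operatorname{depth} R/I^n = \operatorname{depth} R/I^{n_0} \text{ for all } n \geqslant n_0\}.$$ Let $\upsilon(G)$ be the number of vertices of $G$ and $\varepsilon_0(G)$ the number of its leaf edges, i.e. of edges incident with a vertex of degree one. Then the minimum defining $\operatorname{dstab}(I(G))$ exists and $$\operatorname{dstab}(I(G)) = \upsilon(G) - \varepsilon_0(G) - k + 1.$$ -/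

import Mathlib

/-- The edge ideal `I(G) = (x_i x_j | {i, j} ∈ E(G))` of `K[x_v | v ∈ V]`. -/
noncomputable def edgeIdeal {V : Type*} (K : Type*) [Field K] (G : SimpleGraph V) :
    Ideal (MvPolynomial V K) :=
  Ideal.span {f | ∃ i j, G.Adj i j ∧ f = MvPolynomial.X i * MvPolynomial.X j}

/-- The depth of a module `M` over `R = K[x_v | v ∈ V]` with respect to the maximal homogeneous
ideal `𝔪 = (x_v | v ∈ V)`: the supremum of the lengths of the `M`-regular sequences in `𝔪`. -/
noncomputable def polyDepth {V K : Type*} [Field K] (M : Type*) [AddCommGroup M]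
    [Module (MvPolynomial V K) M] : ℕ∞ :=
  ⨆ rs : {rs : List (MvPolynomial V K) // RingTheory.Sequence.IsRegular M rs ∧
      ∀ f ∈ rs, f ∈ MvPolynomial.idealOfVars V K},
    (rs.1.length : ℕ∞)

/-- The integers `n₀ ≥ 1` such that `depth R/I^n = depth R/I^n₀` for all `n ≥ n₀`. -/
def depthStableFrom {V K : Type*} [Field K] (I : Ideal (MvPolynomial V K)) : Set ℕ :=
  {n₀ | 1 ≤ n₀ ∧ ∀ n, n₀ ≤ n →
    polyDepth (V := V) (K := K) (MvPolynomial V K ⧸ I ^ n) =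
      polyDepth (V := V) (K := K) (MvPolynomial V K ⧸ I ^ n₀)}

/-- The index of depth stability of `I` (meaningful when `depthStableFrom I` is nonempty). -/
noncomputable def dstab {V K : Type*} [Field K] (I : Ideal (MvPolynomial V K)) : ℕ :=
  sInf (depthStableFrom I)

/-- The leaf edges of `G`: the edges that contain a vertex of degree one. -/
def leafEdges {V : Type*} (G : SimpleGraph V) : Set (Sym2 V) :=
  {e | e ∈ G.edgeSet ∧ ∃ v ∈ e, (G.neighborSet v).ncard = 1}

/-- The cycles of `G`, as subgraphs (so that the starting point and the direction in which a
cycle is traversed do not matter). -/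
def cycleSubgraphs {V : Type*} (G : SimpleGraph V) : Set G.Subgraph :=
  {H | ∃ (v : V) (p : G.Walk v v), p.IsCycle ∧ p.toSubgraph = H}

/-- A unicyclic graph: a connected graph with exactly one cycle. -/
def IsUnicyclic {V : Type*} (G : SimpleGraph V) : Prop :=
  G.Connected ∧ ∃! H : G.Subgraph, H ∈ cycleSubgraphs G

/-! The depth of `R/I^n` is zero exactly when `𝔪` is associated to `I^n`. Since `I^n` is a monomial
ideal, this asks for a monomial `x^a` outside `I^n` with every `x_v x^a` inside it (`IsCritical`).
Let the cycle have `2m + 1` vertices and let `N` count the non-leaf vertices off the cycle. Critical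
exponents exist exactly for `n ≥ m + 1 + N`, so the depth vanishes from there on and not before. The
formula follows from `k = m + 1` and `υ = 2m + 1 + N + ε₀` (`ncard_leafEdges_add`).

Existence (`IsParent.exists_isCritical`): multiply the cycle vertices, one edge from each inner
vertex to its parent, and spare edges. The degree `2n - 1` is too small for `n` edges, but any
further vertex can be matched by shifting it along its path to the odd cycle.

Lower bound (`IsParent.add_card_le_of_isCritical`): a leaf forces a positive exponent on its
neighbour, and pruning it lowers `n` by its own exponent. Each inner vertex thus costs at least one,
and what remains on the cycle needs `n > m` (`Walk.IsCycle.lt_of_isCritical`). -/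

open Finsupp (single)

/-! ### Packing edges under an exponent vector -/

/-- `G.Packs n a` says that some `n` edges of `G`, taken with multiplicity, have a degree vector
bounded by `a`; equivalently the monomial `x ^ a` lies in the `n`-th power of the edge ideal. -/
def SimpleGraph.Packs {V : Type*} (G : SimpleGraph V) : ℕ → (V →₀ ℕ) → Prop
  | 0, _ => True
  | n + 1, a => ∃ i j b, G.Adj i j ∧ a = b + (single i 1 + single j 1) ∧ G.Packs n b

namespace SimpleGraph

variable {V : Type*} {G : SimpleGraph V}

lemma Packs.add_edge {n : ℕ} {b : V →₀ ℕ} (h : G.Packs n b) {i j : V} (hij : G.Adj i j) :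
    G.Packs (n + 1) (b + (single i 1 + single j 1)) :=
  ⟨i, j, b, hij, rfl, h⟩

lemma Packs.add_right {n : ℕ} {a : V →₀ ℕ} (h : G.Packs n a) (c : V →₀ ℕ) :
    G.Packs n (a + c) := by
  induction n generalizing a with
  | zero => trivial
  | succ n ih =>
    obtain ⟨i, j, b, hij, rfl, hb⟩ := h
    exact ⟨i, j, b + c, hij, by abel, ih hb⟩

lemma Packs.mono {n : ℕ} {a b : V →₀ ℕ} (h : G.Packs n a) (hab : a ≤ b) : G.Packs n b := by
  obtain ⟨c, rfl⟩ := le_iff_exists_add.mp hab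
  exact h.add_right c

lemma Packs.add {m n : ℕ} {a b : V →₀ ℕ} (ha : G.Packs m a) (hb : G.Packs n b) :
    G.Packs (m + n) (a + b) := by
  induction n generalizing b with
  | zero => exact ha.add_right b
  | succ n ih =>
    obtain ⟨i, j, b, hij, rfl, hb⟩ := hb
    exact ⟨i, j, a + b, hij, by abel, ih hb⟩

lemma Packs.two_mul_le_degree {n : ℕ} {a : V →₀ ℕ} (h : G.Packs n a) : 2 * n ≤ a.degree := by
  induction n generalizing a with
  | zero => simp
  | succ n ih =>
    obtain ⟨i, j, b, -, rfl, hb⟩ := h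
    have := ih hb
    simp only [map_add, Finsupp.degree_single]
    omega

lemma exists_eq_add_single {a : V →₀ ℕ} {v : V} (h : a v ≠ 0) : ∃ b, a = b + single v 1 := by
  classical
  refine ⟨a - single v 1, (tsub_add_cancel_of_le ?_).symm⟩
  rw [Finsupp.single_le_iff]
  omega

/-- A vertex without an available neighbour does not help to pack edges. -/
lemma Packs.of_add_isolated {n : ℕ} {a : V →₀ ℕ} {v : V} (hv : ∀ w, G.Adj v w → a w = 0)
    (h : G.Packs n (a + single v 1)) : G.Packs n a := by
  classical
  induction n generalizing a with
  | zero => trivial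
  | succ n ih =>
    obtain ⟨i, j, b, hij, hab, hb⟩ := h
    have key : ∀ w, a w + single v 1 w = b w + (single i 1 w + single j 1 w) :=
      fun w ↦ by simpa using DFunLike.congr_fun hab w
    -- An edge at `v` would need a neighbour with positive exponent. So the edge avoids `v`, whose
    -- extra unit stays in `b`.
    have hiv : i ≠ v := by
      rintro rfl
      have h1 := key j
      have h2 := hv j hij
      simp [hij.ne] at h1
      omega
    have hjv : j ≠ v := by
      rintro rfl
      have h1 := key i
      have h2 := hv i hij.symm
      simp [hij.ne'] at h1
      omega
    have hbv : b v ≠ 0 := by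
      have h1 := key v
      simp [hiv, hjv] at h1
      omega
    obtain ⟨c, rfl⟩ := exists_eq_add_single hbv
    have hac : a = c + (single i 1 + single j 1) := by
      apply add_right_cancel (b := single v 1)
      rw [hab]; abel
    refine ⟨i, j, c, hij, hac, ih (fun w hw ↦ ?_) hb⟩
    have := hv w hw
    rw [hac] at this
    simp at this
    omega

/-- If `u` is the only available neighbour of `l`, then an optimal packing may use the edge
`{l, u}`. -/
lemma Packs.of_add_leaf {n : ℕ} {a : V →₀ ℕ} {l u : V} (hlu : G.Adj l u)
    (hl : ∀ w, G.Adj l w → w ≠ u → a w = 0)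
    (h : G.Packs (n + 1) (a + (single l 1 + single u 1))) : G.Packs n a := by
  classical
  induction n generalizing a with
  | zero => trivial
  | succ n ih =>
    obtain ⟨i, j, b, hij, hab, hb⟩ := h
    have key : ∀ w, a w + (single l 1 w + single u 1 w) = b w + (single i 1 w + single j 1 w) :=
      fun w ↦ by simpa using DFunLike.congr_fun hab w
    by_cases hsame : s(i, j) = s(l, u)
    · have : single i 1 + single j 1 = (single l 1 + single u 1 : V →₀ ℕ) := by
        rcases Sym2.eq_iff.mp hsame with ⟨rfl, rfl⟩ | ⟨rfl, rfl⟩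
        · rfl
        · exact add_comm _ _
      rw [this] at hab
      rwa [add_right_cancel hab]
    have hil : i ≠ l := by
      rintro rfl
      have hju : j ≠ u := by rintro rfl; exact hsame rfl
      have h1 := key j
      have h2 := hl j hij hju
      simp [hij.ne, hju.symm] at h1
      omega
    have hjl : j ≠ l := by
      rintro rfl
      have hiu : i ≠ u := by rintro rfl; exact hsame Sym2.eq_swap
      have h1 := key i
      have h2 := hl i hij.symm hiu
      simp [hij.ne', hiu.symm] at h1
      omega
    have hbl : b l ≠ 0 := by
      have h1 := key l
      simp [hil, hjl] at h1
      omega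
    obtain ⟨c, rfl⟩ := exists_eq_add_single hbl
    have hac : a + single u 1 = c + (single i 1 + single j 1) := by
      apply add_right_cancel (b := single l 1)
      rw [add_assoc, add_comm (single u 1), hab]; abel
    have hc : ∀ w, G.Adj l w → w ≠ u → c w = 0 := by
      intro w hw hwu
      have h1 := hl w hw hwu
      have h2 := DFunLike.congr_fun hac w
      simp [hwu.symm] at h2
      omega
    -- If `u` is used up, `l` is isolated in `c`: drop it together with the edge `{i, j}`. Otherwise
    -- `{l, u}` is still available after removing `{i, j}`, and induction applies.
    by_cases hcu : c u = 0
    · have hcn : G.Packs (n + 1) c := Packs.of_add_isolated (v := l) (fun w hw ↦ by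
        by_cases hwu : w = u
        · rwa [hwu]
        · exact hc w hw hwu) hb
      refine hcn.mono fun w ↦ ?_
      have h2 := DFunLike.congr_fun hac w
      by_cases hwu : w = u
      · subst hwu; omega
      · simp [Finsupp.single_apply, Ne.symm hwu] at h2
        omega
    · obtain ⟨d, rfl⟩ := exists_eq_add_single hcu
      have had : a = d + (single i 1 + single j 1) := by
        apply add_right_cancel (b := single u 1)
        rw [hac]; abel
      rw [had]
      refine (ih (a := d) (fun w hw hwu ↦ ?_) ?_).add_edge hij
      · have := hc w hw hwu
        simp at this
        omega
      · rwa [add_comm (single l 1), ← add_assoc]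

/-! ### Critical exponents and pruning -/

/-- `a` is supported on `S`, does not contain `n` edges, but does so after raising any exponent
with index in `S`. -/
structure IsCritical (G : SimpleGraph V) (S : Set V) (n : ℕ) (a : V →₀ ℕ) : Prop where
  eq_zero : ∀ v ∉ S, a v = 0
  not_packs : ¬ G.Packs n a
  packs : ∀ v ∈ S, G.Packs n (a + single v 1)

lemma IsCritical.exists_adj {S : Set V} {n : ℕ} {a : V →₀ ℕ} (h : G.IsCritical S n a) {v : V}
    (hv : v ∈ S) : ∃ w ∈ S, G.Adj v w ∧ a w ≠ 0 := by
  by_contra! H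
  refine h.not_packs (Packs.of_add_isolated (fun w hw ↦ ?_) (h.packs v hv))
  by_cases hw' : w ∈ S
  · exact H w hw' hw
  · exact h.eq_zero w hw'

/-- Pruning a leaf `l` with neighbour `u`. -/
lemma IsCritical.prune {S : Set V} {n : ℕ} {a : V →₀ ℕ} (h : G.IsCritical S n a) {l u : V}
    (hl : l ∈ S) (hlu : G.Adj l u) (hleaf : ∀ w ∈ S, G.Adj l w → w = u) :
    ∃ n' a', G.IsCritical (S \ {l}) n' a' ∧ n = n' + a l ∧ a' u ≠ 0 ∧
      ∀ w, w ≠ l → w ≠ u → a' w = a w := by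
  classical
  have hau : ∀ {n a}, G.IsCritical S n a → a u ≠ 0 := by
    intro n a h
    obtain ⟨w, hwS, hw, haw⟩ := h.exists_adj hl
    rwa [← hleaf w hwS hw]
  obtain ⟨m, hm⟩ : ∃ m, a l = m := ⟨_, rfl⟩
  induction m generalizing n a with
  | zero =>
    refine ⟨n, a, ⟨fun v hv ↦ ?_, h.not_packs, fun v hv ↦ h.packs v hv.1⟩, by omega, hau h,
      fun _ _ _ ↦ rfl⟩
    by_cases hvl : v = l
    · rwa [hvl]
    · exact h.eq_zero v fun hvS ↦ hv ⟨hvS, hvl⟩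
  | succ m ih =>
    -- As `a u ≠ 0`, one copy of `{l, u}` splits off; by `Packs.of_add_leaf` the rest is critical
    -- for `n - 1`.
    obtain ⟨b, hb⟩ := exists_eq_add_single (hau h)
    have hbl : b l ≠ 0 := by
      rw [hb] at hm
      simp [hlu.ne'] at hm
      omega
    obtain ⟨c, rfl⟩ := exists_eq_add_single hbl
    rw [add_assoc] at hb
    subst hb
    obtain ⟨n, rfl⟩ : ∃ k, n = k + 1 := by
      cases n with
      | zero => exact absurd trivial h.not_packs
      | succ k => exact ⟨k, rfl⟩
    have hc : ∀ v ∉ S, c v = 0 := fun v hv ↦ by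
      have := h.eq_zero v hv
      simp at this
      exact this.1
    have hcrit : G.IsCritical S n c := by
      refine ⟨hc, fun H ↦ h.not_packs (H.add_edge hlu), fun v hv ↦ ?_⟩
      refine Packs.of_add_leaf hlu (fun w hw hwu ↦ ?_) (by
        simpa [add_comm, add_left_comm, add_assoc] using h.packs v hv)
      have hwS : w ∉ S := fun hwS ↦ hwu (hleaf w hwS hw)
      have hwv : v ≠ w := fun e ↦ hwS (e ▸ hv)
      simp [hc w hwS, hwv]
    have hcl : c l = m := by
      simp [hlu.ne'] at hm
      omega
    obtain ⟨n', a', h1, h2, h3, h4⟩ := ih hcrit hcl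
    refine ⟨n', a', h1, by omega, h3, fun w hwl hwu ↦ ?_⟩
    rw [h4 w hwl hwu]
    simp [hwl.symm, hwu.symm]

end SimpleGraph

/-! ### Depth zero in terms of monomials -/

section Algebra

open MvPolynomial

variable {V K : Type*} [Field K]

lemma edgeIdeal_pow_eq_span (G : SimpleGraph V) (n : ℕ) :
    edgeIdeal K G ^ n =
      Ideal.span ((fun s ↦ monomial s (1 : K)) '' {a | G.Packs n a}) := by
  induction n with
  | zero =>
    rw [pow_zero, Ideal.one_eq_top, eq_comm, Ideal.eq_top_iff_one]
    exact Ideal.subset_span ⟨0, trivial, rfl⟩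
  | succ n ih =>
    rw [pow_succ, ih, edgeIdeal, Ideal.span_mul_span']
    apply le_antisymm
    · refine Ideal.span_mono ?_
      rintro _ ⟨_, ⟨a, ha, rfl⟩, _, ⟨i, j, hij, rfl⟩, rfl⟩
      refine ⟨_, SimpleGraph.Packs.add_edge ha hij, ?_⟩
      simp [X, monomial_mul]
    · refine Ideal.span_mono ?_
      rintro _ ⟨_, ⟨i, j, b, hij, rfl, hb⟩, rfl⟩
      refine ⟨_, ⟨b, hb, rfl⟩, _, ⟨i, j, hij, rfl⟩, ?_⟩
      simp [X, monomial_mul]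

lemma mem_edgeIdeal_pow_iff (G : SimpleGraph V) (n : ℕ) (f : MvPolynomial V K) :
    f ∈ edgeIdeal K G ^ n ↔ ∀ a ∈ f.support, G.Packs n a := by
  rw [edgeIdeal_pow_eq_span, mem_ideal_span_monomial_image]
  exact forall₂_congr fun a _ ↦ ⟨fun ⟨b, hb, hba⟩ ↦ SimpleGraph.Packs.mono hb hba,
    fun h ↦ ⟨a, h, le_rfl⟩⟩

lemma length_le_polyDepth {M : Type*} [AddCommGroup M] [Module (MvPolynomial V K) M]
    {rs : List (MvPolynomial V K)} (hreg : RingTheory.Sequence.IsRegular M rs)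
    (hmem : ∀ f ∈ rs, f ∈ idealOfVars V K) :
    (rs.length : ℕ∞) ≤ polyDepth (V := V) (K := K) M :=
  le_iSup_of_le ⟨rs, hreg, hmem⟩ le_rfl

/-- A socle element of `M` forces the depth to vanish. -/
lemma polyDepth_eq_zero_of_socle {M : Type*} [AddCommGroup M] [Module (MvPolynomial V K) M]
    {x : M} (hx : x ≠ 0) (h : ∀ v, (X v : MvPolynomial V K) • x = 0) :
    polyDepth (V := V) (K := K) M = 0 := by
  have hann : idealOfVars V K ≤ LinearMap.ker (LinearMap.toSpanSingleton _ M x) := by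
    rw [Ideal.span_le]
    rintro _ ⟨v, rfl⟩
    simpa using h v
  rw [polyDepth, ← nonpos_iff_eq_zero, iSup_le_iff]
  rintro ⟨_ | ⟨f, rs⟩, hreg, hmem⟩
  · simp
  · rw [RingTheory.Sequence.isRegular_cons_iff] at hreg
    have hf : f • x = 0 := by simpa using hann (hmem f (by simp))
    exact absurd (hreg.1.right_eq_zero_of_smul hf) hx

/-- Over finitely many variables, a module `M ≠ 𝔪 M` of depth zero has a socle element. -/
lemma exists_socle_of_polyDepth_eq_zero [Finite V] {M : Type*} [AddCommGroup M]
    [Module (MvPolynomial V K) M] [Module.Finite (MvPolynomial V K) M]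
    (hM : idealOfVars V K • (⊤ : Submodule (MvPolynomial V K) M) ≠ ⊤)
    (h : polyDepth (V := V) (K := K) M = 0) :
    ∃ x : M, x ≠ 0 ∧ ∀ v, (X v : MvPolynomial V K) • x = 0 := by
  -- Depth zero makes `𝔪` consist of zero divisors. Prime avoidance then puts it inside a single
  -- associated prime, the annihilator of some `x`.
  have hsub : (idealOfVars V K : Set (MvPolynomial V K)) ⊆
      ⋃ p ∈ associatedPrimes (MvPolynomial V K) M, (p : Set (MvPolynomial V K)) := by
    rw [biUnion_associatedPrimes_eq_compl_regular]
    intro f hf hreg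
    have hreg' : RingTheory.Sequence.IsRegular M [f] := by
      refine ⟨(RingTheory.Sequence.isWeaklyRegular_singleton_iff M f).mpr hreg, fun htop ↦ hM ?_⟩
      refine top_le_iff.mp (htop.le.trans (Submodule.smul_mono_left ?_))
      rw [Ideal.ofList_singleton, Ideal.span_singleton_le_iff_mem]
      exact hf
    have := length_le_polyDepth hreg' (by simpa using hf)
    simp [h] at this
  obtain ⟨P, hP, hle⟩ := (Ideal.subset_union_prime_finite
    (associatedPrimes.finite (MvPolynomial V K) M) (f := id) ⊥ ⊥ fun _ h _ _ ↦ h.isPrime).mp hsub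
  obtain ⟨hprime, x, hx⟩ := Submodule.isAssociatedPrime_iff.mp hP
  refine ⟨x, ?_, fun v ↦ ?_⟩
  · rintro rfl
    apply hprime.ne_top
    rw [hx, Ideal.eq_top_iff_one]
    simp [Submodule.mem_colon_singleton]
  · have : (X v : MvPolynomial V K) ∈ P := hle (Ideal.subset_span ⟨v, rfl⟩)
    rwa [hx, Submodule.mem_colon_singleton, Submodule.mem_bot] at this

/-- The depth of `R / I(G) ^ n` vanishes exactly if `𝔪` is an associated prime, which can be
tested on monomials. -/
lemma polyDepth_edgeIdeal_pow_eq_zero_iff [Finite V] (G : SimpleGraph V) {n : ℕ} (hn : n ≠ 0) :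
    polyDepth (V := V) (K := K) (MvPolynomial V K ⧸ edgeIdeal K G ^ n) = 0 ↔
      ∃ a, G.IsCritical Set.univ n a := by
  classical
  constructor
  · intro h
    -- This needs `n ≠ 0`: for `n = 0` the quotient is zero and its depth is an empty supremum, `0`,
    -- although no exponent is critical.
    have hle : edgeIdeal K G ^ n ≤ idealOfVars V K := by
      refine (Ideal.pow_le_self hn).trans (Ideal.span_le.mpr ?_)
      rintro _ ⟨i, j, -, rfl⟩
      exact Ideal.mul_mem_right _ _ (Ideal.subset_span ⟨i, rfl⟩)
    have hne : idealOfVars V K ≠ ⊤ := by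
      rw [Ne, Ideal.eq_top_iff_one, ← pow_one (idealOfVars V K), ← C_1,
        C_mem_pow_idealOfVars_iff]
      simp
    have hM : idealOfVars V K •
        (⊤ : Submodule (MvPolynomial V K) (MvPolynomial V K ⧸ edgeIdeal K G ^ n)) ≠ ⊤ := by
      refine fun htop ↦ hne ?_
      rw [eq_top_iff]
      intro r _
      have hr : (Ideal.Quotient.mk (edgeIdeal K G ^ n)) r ∈
          idealOfVars V K • (⊤ : Submodule (MvPolynomial V K) (_ ⧸ edgeIdeal K G ^ n)) :=
        htop.ge Submodule.mem_top
      have hmap : idealOfVars V K • (⊤ : Submodule (MvPolynomial V K) (_ ⧸ edgeIdeal K G ^ n)) ≤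
          Submodule.map (Submodule.mkQ (edgeIdeal K G ^ n)) (idealOfVars V K) := by
        rw [Submodule.smul_le]
        intro s hs y _
        obtain ⟨t, rfl⟩ := Submodule.mkQ_surjective _ y
        exact ⟨s * t, Ideal.mul_mem_right _ _ hs, rfl⟩
      obtain ⟨s, hs, hsr⟩ := hmap hr
      have : r - s ∈ edgeIdeal K G ^ n := Ideal.Quotient.eq.mp hsr.symm
      simpa using add_mem (hle this) hs
    obtain ⟨x, hx0, hx⟩ := exists_socle_of_polyDepth_eq_zero hM h
    obtain ⟨f, rfl⟩ := Ideal.Quotient.mk_surjective x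
    rw [Ne, Ideal.Quotient.eq_zero_iff_mem, mem_edgeIdeal_pow_iff] at hx0
    push Not at hx0
    obtain ⟨a, ha, hna⟩ := hx0
    refine ⟨a, by simp, hna, fun v _ ↦ ?_⟩
    have hv : X v * f ∈ edgeIdeal K G ^ n := by
      rw [← Ideal.Quotient.eq_zero_iff_mem]
      exact hx v
    rw [mem_edgeIdeal_pow_iff] at hv
    refine hv _ ?_
    rwa [mem_support_iff, add_comm, coeff_X_mul, ← mem_support_iff]
  · rintro ⟨a, ha⟩
    refine polyDepth_eq_zero_of_socle (x := Ideal.Quotient.mk _ (monomial a 1)) ?_ fun v ↦ ?_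
    · rw [Ne, Ideal.Quotient.eq_zero_iff_mem, mem_edgeIdeal_pow_iff]
      simpa [support_monomial] using ha.not_packs
    · change Ideal.Quotient.mk _ (X v * monomial a 1) = 0
      rw [Ideal.Quotient.eq_zero_iff_mem, mem_edgeIdeal_pow_iff, X, monomial_mul]
      simpa [support_monomial, add_comm] using ha.packs v trivial

end Algebra

/-! ### Structure of unicyclic graphs -/

namespace SimpleGraph

variable {V : Type*} {G : SimpleGraph V}

/-- Deleting an edge of the cycle leaves a spanning tree: the edge is not a bridge, and any
surviving cycle would be the unique one and contain it. -/
lemma edgeSet_ncard_le_of_isUnicyclic [Fintype V] (hG : IsUnicyclic G) :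
    G.edgeSet.ncard ≤ Fintype.card V := by
  classical
  obtain ⟨hconn, H, ⟨v, C, hC, rfl⟩, huniq⟩ := hG
  obtain ⟨e, he⟩ : ∃ e, e ∈ C.edges := by
    refine List.exists_mem_of_length_pos ?_
    rw [Walk.length_edges]
    have := hC.three_le_length
    omega
  have hT : (G.deleteEdges {e}).IsTree := by
    refine ⟨?_, fun u c hc ↦ ?_⟩
    · induction e with | _ x y
      exact hconn.connected_delete_edge_of_not_isBridge fun hb ↦
        hb.notMem_edges_of_isCycle hC he
    · have hle : G.deleteEdges {e} ≤ G := G.deleteEdges_le {e}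
      have h1 := huniq _ ⟨u, c.mapLe hle, hc.mapLe hle, rfl⟩
      have h2 : e ∈ c.edges := by
        rw [← Walk.edges_mapLe_eq_edges hle, ← Walk.mem_edges_toSubgraph, h1,
          Walk.mem_edges_toSubgraph]
        exact he
      have h3 := c.edges_subset_edgeSet h2
      simp [edgeSet_deleteEdges] at h3
  have hcard := hT.card_edgeFinset
  have hsub : G.edgeSet ⊆ insert e (G.deleteEdges {e}).edgeSet := by
    intro x hx
    by_cases hxe : x = e
    · exact Or.inl hxe
    · exact Or.inr (by simp [edgeSet_deleteEdges, hx, hxe])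
  calc G.edgeSet.ncard ≤ _ := Set.ncard_le_ncard hsub (Set.toFinite _)
    _ ≤ (G.deleteEdges {e}).edgeSet.ncard + 1 := Set.ncard_insert_le _ _
    _ = Fintype.card V := by
      rw [← hcard, ← coe_edgeFinset, Set.ncard_coe_finset]

lemma Connected.exists_adj_dist_lt (hG : G.Connected) {w v : V} (h : w ≠ v) :
    ∃ x, G.Adj w x ∧ G.dist x v < G.dist w v := by
  obtain ⟨p, hp⟩ := hG.exists_walk_length_eq_dist w v
  cases p with
  | nil => exact absurd rfl h
  | cons hadj q =>
    refine ⟨_, hadj, ?_⟩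
    rw [← hp, Walk.length_cons]
    exact Nat.lt_succ_of_le (dist_le q)

/-- The vertices of a cycle are the first `C.length` values of `C.getVert`. -/
lemma Walk.IsCycle.image_getVert_eq_support [DecidableEq V] {v : V} {C : G.Walk v v}
    (hC : C.IsCycle) :
    (Finset.range C.length).image C.getVert = C.support.toFinset := by
  have := hC.three_le_length
  ext x
  simp only [Finset.mem_image, Finset.mem_range, List.mem_toFinset,
    Walk.mem_support_iff_exists_getVert]
  constructor
  · rintro ⟨i, hi, rfl⟩
    exact ⟨i, rfl, hi.le⟩
  · rintro ⟨i, rfl, hi⟩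
    rcases hi.eq_or_lt with h | h
    · exact ⟨0, by omega, by rw [h, Walk.getVert_length, Walk.getVert_zero]⟩
    · exact ⟨i, h, rfl⟩

lemma Walk.IsCycle.injOn_getVert_range {v : V} {C : G.Walk v v} (hC : C.IsCycle) :
    Set.InjOn C.getVert (Finset.range C.length) := by
  have := hC.three_le_length
  refine hC.getVert_injOn'.mono fun i hi ↦ ?_
  simp only [Finset.coe_range, Set.mem_Iio] at hi
  simp only [Set.mem_ofPred_eq]
  omega

lemma Walk.IsCycle.card_support_toFinset [DecidableEq V] {v : V} {C : G.Walk v v}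
    (hC : C.IsCycle) : C.support.toFinset.card = C.length := by
  rw [← hC.image_getVert_eq_support, Finset.card_image_of_injOn hC.injOn_getVert_range,
    Finset.card_range]

/-- The trees attached to a set `S` of vertices, encoded by a parent function `p` on the complement
of `S` that decreases a rank function `r`. -/
structure IsParent (G : SimpleGraph V) (S : Set V) (p : V → V) (r : V → ℕ) : Prop where
  adj : ∀ w ∉ S, G.Adj w (p w)
  lt : ∀ w ∉ S, r (p w) < r w
  eq_or_eq : ∀ x y, G.Adj x y → x ∉ S ∨ y ∉ S → (x ∉ S ∧ p x = y) ∨ (y ∉ S ∧ p y = x)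

lemma IsParent.injOn {S : Set V} {p : V → V} {r : V → ℕ} (h : G.IsParent S p r) :
    Set.InjOn (fun w ↦ s(w, p w)) Sᶜ := by
  intro x hx y hy hxy
  rcases Sym2.eq_iff.mp hxy with h1 | ⟨h1, h2⟩
  · exact h1.1
  · have h3 := h.lt x hx
    have h4 := h.lt y hy
    rw [h2] at h3
    rw [← h1] at h4
    omega

/-- A unicyclic graph consists of its cycle, whose only edges are the obvious ones, and of trees
attached to it. -/
lemma exists_isParent_of_isUnicyclic [Fintype V] (hG : IsUnicyclic G) {v : V} {C : G.Walk v v}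
    (hC : C.IsCycle) :
    (∃ p r, G.IsParent {w | w ∈ C.support} p r) ∧
      ∀ x y, G.Adj x y → x ∈ C.support → y ∈ C.support → s(x, y) ∈ C.edges := by
  classical
  have hex : ∀ w, ∃ x, w ∉ C.support → G.Adj w x ∧ G.dist x v < G.dist w v := by
    intro w
    by_cases hw : w ∈ C.support
    · exact ⟨w, fun h ↦ absurd hw h⟩
    · obtain ⟨x, hx⟩ := hG.1.exists_adj_dist_lt (w := w) (v := v)
        (by rintro rfl; exact hw C.start_mem_support)
      exact ⟨x, fun _ ↦ hx⟩
  choose p hp using hex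
  have hinj : Set.InjOn (fun w ↦ s(w, p w)) ({w | w ∉ C.support} : Set V) := by
    intro x hx y hy hxy
    rcases Sym2.eq_iff.mp hxy with h1 | ⟨h1, h2⟩
    · exact h1.1
    · have h3 := (hp x hx).2
      have h4 := (hp y hy).2
      rw [h2] at h3
      rw [← h1] at h4
      omega
  -- The parent edges and the cycle edges are disjoint and number `|V|` in total, so by the edge
  -- count they are all the edges.
  set A : Finset (Sym2 V) := (C.support.toFinsetᶜ).image fun w ↦ s(w, p w) with hA
  have hAcard : A.card = Fintype.card V - C.length := by
    rw [hA, Finset.card_image_of_injOn (hinj.mono fun w hw ↦ by simpa using hw),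
      Finset.card_compl, hC.card_support_toFinset]
  have hBcard : C.edges.toFinset.card = C.length := by
    rw [List.toFinset_card_of_nodup hC.isTrail.edges_nodup, Walk.length_edges]
  have hdisj : Disjoint A C.edges.toFinset := by
    rw [Finset.disjoint_left]
    intro e he he'
    obtain ⟨w, hw, rfl⟩ := Finset.mem_image.mp he
    simp only [Finset.mem_compl, List.mem_toFinset] at hw he'
    exact hw (C.fst_mem_support_of_mem_edges he')
  have hsub : A ∪ C.edges.toFinset ⊆ G.edgeFinset := by
    intro e he
    rw [mem_edgeFinset]
    rcases Finset.mem_union.mp he with he | he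
    · obtain ⟨w, hw, rfl⟩ := Finset.mem_image.mp he
      exact (hp w (by simpa using hw)).1
    · exact C.edges_subset_edgeSet (List.mem_toFinset.mp he)
  have hle : C.length ≤ Fintype.card V := by
    rw [← hC.card_support_toFinset]
    exact Finset.card_le_univ _
  have heq : A ∪ C.edges.toFinset = G.edgeFinset := by
    refine Finset.eq_of_subset_of_card_le hsub ?_
    rw [Finset.card_union_of_disjoint hdisj, hAcard, hBcard, Nat.sub_add_cancel hle,
      ← Set.ncard_coe_finset, coe_edgeFinset]
    exact edgeSet_ncard_le_of_isUnicyclic hG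
  have hedge : ∀ x y, G.Adj x y →
      (x ∉ C.support ∧ p x = y) ∨ (y ∉ C.support ∧ p y = x) ∨ s(x, y) ∈ C.edges := by
    intro x y hxy
    have : s(x, y) ∈ A ∪ C.edges.toFinset := by
      rw [heq, mem_edgeFinset]
      exact hxy
    rcases Finset.mem_union.mp this with h | h
    · obtain ⟨w, hw, hwe⟩ := Finset.mem_image.mp h
      have hw' : w ∉ C.support := by simpa using hw
      rcases Sym2.eq_iff.mp hwe with ⟨rfl, h2⟩ | ⟨rfl, h2⟩
      · exact Or.inl ⟨hw', h2⟩
      · exact Or.inr (Or.inl ⟨hw', h2⟩)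
    · exact Or.inr (Or.inr (List.mem_toFinset.mp h))
  refine ⟨⟨p, fun w ↦ G.dist w v, fun w hw ↦ (hp w hw).1, fun w hw ↦ (hp w hw).2,
    fun x y hxy hmem ↦ ?_⟩, fun x y hxy hx hy ↦ ?_⟩
  · rcases hedge x y hxy with h | h | h
    · exact Or.inl h
    · exact Or.inr h
    · rcases hmem with hx | hy
      · exact absurd (C.fst_mem_support_of_mem_edges h) hx
      · exact absurd (C.snd_mem_support_of_mem_edges h) hy
  · rcases hedge x y hxy with h | h | h
    · exact absurd hx h.1
    · exact absurd hy h.1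
    · exact h

/-- The vertices outside of `S` that have a child. -/
def innerVertices (S : Set V) (p : V → V) : Set V := {w | w ∉ S ∧ ∃ z ∉ S, p z = w}

/-- If all vertices of `S` have at least two neighbours, then the leaf edges are those from a
childless vertex to its parent. -/
lemma ncard_leafEdges_add [Fintype V] {S : Set V} {p : V → V} {r : V → ℕ}
    (h : G.IsParent S p r) (hS : ∀ v ∈ S, 1 < (G.neighborSet v).ncard) :
    (leafEdges G).ncard + (innerVertices S p).ncard + S.ncard = Fintype.card V := by
  classical
  have hleaf : leafEdges G = (fun w ↦ s(w, p w)) '' (Sᶜ \ innerVertices S p) := by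
    ext e
    constructor
    · rintro ⟨he, v, hve, hv⟩
      have hvS : v ∉ S := fun hvS ↦ by have := hS v hvS; omega
      obtain ⟨x, hx⟩ := Set.ncard_eq_one.mp hv
      have hpv : p v = x := by
        have : p v ∈ G.neighborSet v := h.adj v hvS
        rwa [hx] at this
      obtain ⟨y, rfl⟩ := Sym2.mem_iff_exists.mp hve
      have hy : y = x := by
        have : y ∈ G.neighborSet v := he
        rwa [hx] at this
      refine ⟨v, ⟨hvS, ?_⟩, by simp only [hpv, hy]⟩
      -- A child would have to be the only neighbour, hence the parent, against the rank.
      rintro ⟨-, z, hzS, hzv⟩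
      have hz : z ∈ G.neighborSet v := hzv ▸ (h.adj z hzS).symm
      rw [hx] at hz
      have h1 := h.lt z hzS
      have h2 := h.lt v hvS
      rw [hzv] at h1
      rw [hpv, ← Set.mem_singleton_iff.mp hz] at h2
      omega
    · rintro ⟨w, ⟨hwS, hw⟩, rfl⟩
      refine ⟨h.adj w hwS, w, by simp, ?_⟩
      rw [Set.ncard_eq_one]
      refine ⟨p w, Set.eq_singleton_iff_unique_mem.mpr ⟨h.adj w hwS, fun y hy ↦ ?_⟩⟩
      rcases h.eq_or_eq w y hy (Or.inl hwS) with h1 | h1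
      · exact h1.2.symm
      · exact absurd ⟨hwS, y, h1⟩ hw
  have hsub : innerVertices S p ⊆ Sᶜ := fun w hw ↦ hw.1
  rw [hleaf, (h.injOn.mono Set.sdiff_subset).ncard_image,
    Set.ncard_sdiff_add_ncard_of_subset hsub, add_comm, Set.ncard_add_ncard_compl,
    Nat.card_eq_fintype_card]

end SimpleGraph

/-! ### Construction of critical exponents -/

namespace SimpleGraph

variable {V : Type*} {G : SimpleGraph V}

lemma Packs.of_le {m n : ℕ} {a : V →₀ ℕ} (h : G.Packs n a) (hmn : m ≤ n) : G.Packs m a := by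
  induction n, hmn using Nat.le_induction generalizing a with
  | base => exact h
  | succ n _ ih =>
    obtain ⟨i, j, b, -, rfl, hb⟩ := h
    exact (ih hb).add_right _

lemma packs_sum_edges {ι : Type*} (s : Finset ι) (f g : ι → V)
    (h : ∀ i ∈ s, G.Adj (f i) (g i)) :
    G.Packs s.card (∑ i ∈ s, (single (f i) 1 + single (g i) 1)) := by
  classical
  induction s using Finset.induction_on with
  | empty => trivial
  | insert i s hi ih =>
    rw [Finset.card_insert_of_notMem hi, Finset.sum_insert hi, add_comm (single _ _ + _)]
    exact (ih fun j hj ↦ h j (Finset.mem_insert_of_mem hj)).add_edge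
      (h i (Finset.mem_insert_self i s))

lemma packs_sum_range_two_mul (m : ℕ) (g : ℕ → V)
    (h : ∀ i < m, G.Adj (g (2 * i)) (g (2 * i + 1))) :
    G.Packs m (∑ i ∈ Finset.range (2 * m), single (g i) 1) := by
  induction m with
  | zero => trivial
  | succ m ih =>
    rw [Nat.mul_succ, Finset.sum_range_succ, Finset.sum_range_succ, add_assoc]
    exact (ih fun i hi ↦ h i (by omega)).add_edge (h m (by omega))

/-- An odd cycle has a perfect matching after deleting or doubling any of its vertices. -/
lemma Walk.IsCycle.packs_of_odd [DecidableEq V] {v : V} {C : G.Walk v v} (hC : C.IsCycle) {m : ℕ}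
    (hm : C.length = 2 * m + 1) {c : V} (hc : c ∈ C.support) :
    (∃ b, ∑ x ∈ C.support.toFinset, single x 1 = b + single c 1 ∧ G.Packs m b) ∧
      G.Packs (m + 1) (∑ x ∈ C.support.toFinset, single x 1 + single c 1) := by
  wlog hcv : c = v generalizing v C
  · have hsupp : (C.rotate c hc).support.toFinset = C.support.toFinset := by
      ext x; simp
    rw [← hsupp]
    exact this (hC.rotate hc) (by simpa using hm) (Walk.start_mem_support _) rfl
  subst hcv
  have hsum : ∑ x ∈ C.support.toFinset, single x 1 =
      ∑ i ∈ Finset.range (2 * m + 1), (single (C.getVert i) 1 : V →₀ ℕ) := by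
    rw [← hC.image_getVert_eq_support, hm, Finset.sum_image]
    rw [← hm]
    exact hC.injOn_getVert_range
  rw [hsum]
  refine ⟨⟨∑ i ∈ Finset.range (2 * m), single (C.getVert (i + 1)) 1, ?_, ?_⟩, ?_⟩
  · rw [Finset.sum_range_succ', Walk.getVert_zero]
  · exact packs_sum_range_two_mul m _ fun i hi ↦ C.adj_getVert_succ (by omega)
  · have hlast : C.getVert (2 * m + 1) = c := by rw [← hm, Walk.getVert_length]
    have := packs_sum_range_two_mul (m + 1) C.getVert (G := G)
      fun i hi ↦ C.adj_getVert_succ (by omega)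
    rwa [Nat.mul_succ, Finset.sum_range_succ, hlast] at this

/-- Climbing from `u` to `S` along the parents, one can shift a surplus or a defect at `u`
to `S`. -/
lemma IsParent.exists_packs {S : Set V} {p : V → V} {r : V → ℕ} (h : G.IsParent S p r)
    {o : V →₀ ℕ} {m : ℕ}
    (ho : ∀ c ∈ S, (∃ b, o = b + single c 1 ∧ G.Packs m b) ∧ G.Packs (m + 1) (o + single c 1))
    {u : V} (hu : u ∈ S ∨ u ∈ innerVertices S p) :
    ∃ X : Finset V, (X : Set V) ⊆ innerVertices S p ∧ (∀ x ∈ X, r x ≤ r u) ∧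
      (∃ b, o + ∑ w ∈ X, (single w 1 + single (p w) 1) = b + single u 1 ∧
        G.Packs (X.card + m) b) ∧
      G.Packs (X.card + m + 1) (o + ∑ w ∈ X, (single w 1 + single (p w) 1) + single u 1) := by
  classical
  induction hr : r u using Nat.strong_induction_on generalizing u with
  | _ t ih =>
    by_cases huS : u ∈ S
    · obtain ⟨⟨b, hb⟩, hb'⟩ := ho u huS
      exact ⟨∅, by simp, by simp, ⟨b, by simpa using hb⟩, by simpa using hb'⟩
    have hlt := h.lt u huS
    have hpu : p u ∈ S ∨ p u ∈ innerVertices S p := by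
      by_cases hpS : p u ∈ S
      · exact Or.inl hpS
      · exact Or.inr ⟨hpS, u, huS, rfl⟩
    obtain ⟨X, hX, hXr, ⟨b, hb, hbp⟩, hp⟩ := ih _ (hr ▸ hlt) hpu rfl
    have huX : u ∉ X := fun huX ↦ by have := hXr u huX; omega
    have hadj := h.adj u huS
    -- Adding the edge `{u, p u}` swaps the roles: a surplus at `p u` becomes a defect at `u`, and a
    -- defect at `p u` becomes a surplus at `u`, covered by two copies of the edge.
    refine ⟨insert u X, ?_, ?_, ⟨o + ∑ w ∈ X, (single w 1 + single (p w) 1) + single (p u) 1,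
      ?_, ?_⟩, ?_⟩
    · rw [Finset.coe_insert, Set.insert_subset_iff]
      exact ⟨hu.resolve_left huS, hX⟩
    · intro x hx
      rcases Finset.mem_insert.mp hx with rfl | hx
      · exact hr.le
      · have := hXr x hx
        omega
    · rw [Finset.sum_insert huX]; abel
    · rw [Finset.card_insert_of_notMem huX]
      convert hp using 1
      omega
    · rw [Finset.card_insert_of_notMem huX, Finset.sum_insert huX]
      have := (hbp.add_edge hadj).add_edge hadj
      convert this using 1
      · omega
      · rw [show o + (single u 1 + single (p u) 1 + ∑ w ∈ X, (single w 1 + single (p w) 1)) +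
          single u 1 = (o + ∑ w ∈ X, (single w 1 + single (p w) 1)) +
            (single u 1 + single (p u) 1) + single u 1 by abel, hb]
        abel

/-- Existence of critical exponents in all large degrees. -/
lemma IsParent.exists_isCritical [Finite V] {S : Set V} {p : V → V} {r : V → ℕ}
    (h : G.IsParent S p r) {o : V →₀ ℕ} {m : ℕ}
    (ho : ∀ c ∈ S, (∃ b, o = b + single c 1 ∧ G.Packs m b) ∧ G.Packs (m + 1) (o + single c 1))
    (hdeg : o.degree = 2 * m + 1) {x y : V} (hxy : G.Adj x y) {n : ℕ}
    (hn : m + 1 + (innerVertices S p).ncard ≤ n) :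
    ∃ a, G.IsCritical Set.univ n a := by
  classical
  obtain ⟨t, rfl⟩ := Nat.exists_eq_add_of_le hn
  set N : Finset V := (Set.toFinite (innerVertices S p)).toFinset with hN
  have hmemN : ∀ w, w ∈ N ↔ w ∈ innerVertices S p := fun w ↦ by simp [hN]
  have hNcard : (innerVertices S p).ncard = N.card := Set.ncard_eq_toFinset_card _ _
  rw [hNcard]
  have hadjN : ∀ w ∈ N, G.Adj w (p w) := fun w hw ↦ h.adj w ((hmemN w).mp hw).1
  have hfull : ∀ u, u ∈ S ∨ u ∈ innerVertices S p →
      (∃ b, o + ∑ w ∈ N, (single w 1 + single (p w) 1) = b + single u 1 ∧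
        G.Packs (N.card + m) b) ∧
      G.Packs (N.card + m + 1) (o + ∑ w ∈ N, (single w 1 + single (p w) 1) + single u 1) := by
    intro u hu
    obtain ⟨X, hX, -, ⟨b, hb, hbp⟩, hp⟩ := h.exists_packs ho hu
    have hXN : X ⊆ N := fun w hw ↦ (hmemN w).mpr (hX hw)
    -- Inner vertices off the chain `X` keep their own parent edges.
    have hrest := packs_sum_edges (N \ X) id p
      fun w hw ↦ hadjN w (Finset.mem_sdiff.mp hw).1
    have hcard : N.card = X.card + (N \ X).card := by
      rw [Finset.card_sdiff_of_subset hXN]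
      have := Finset.card_le_card hXN
      omega
    have hsum : ∑ w ∈ N, (single w 1 + single (p w) 1) =
        ∑ w ∈ X, (single w 1 + single (p w) 1) +
          (∑ w ∈ N \ X, (single (id w) 1 + single (p w) 1) : V →₀ ℕ) := by
      rw [add_comm]
      exact (Finset.sum_sdiff hXN).symm
    rw [hsum, hcard]
    refine ⟨⟨b + ∑ w ∈ N \ X, (single (id w) 1 + single (p w) 1), ?_, ?_⟩, ?_⟩
    · rw [← add_assoc, hb]; abel
    · convert hbp.add hrest using 1
      omega
    · convert hp.add hrest using 1
      · omega
      · abel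
  have hedges := packs_sum_edges (Finset.range t) (fun _ ↦ x) (fun _ ↦ y) fun _ _ ↦ hxy
  rw [Finset.card_range] at hedges
  refine ⟨o + ∑ w ∈ N, (single w 1 + single (p w) 1) +
    ∑ _i ∈ Finset.range t, (single x 1 + single y 1), by simp, fun H ↦ ?_, fun v _ ↦ ?_⟩
  · have := H.two_mul_le_degree
    simp only [map_add, map_sum, map_nsmul, Finsupp.degree_single, Finset.sum_const, hdeg, smul_eq_mul,
      Finset.card_range] at this
    omega
  · have hv : G.Packs (N.card + m + 1)
        (o + ∑ w ∈ N, (single w 1 + single (p w) 1) + single v 1) := by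
      by_cases hvN : v ∈ S ∨ v ∈ innerVertices S p
      · exact (hfull v hvN).2
      · push Not at hvN
        have hpv : p v ∈ S ∨ p v ∈ innerVertices S p := by
          by_cases hpS : p v ∈ S
          · exact Or.inl hpS
          · exact Or.inr ⟨hpS, v, hvN.1, rfl⟩
        -- A childless `v` is matched with its parent, which the rest can spare.
        obtain ⟨⟨b, hb, hbp⟩, -⟩ := hfull _ hpv
        rw [hb]
        convert hbp.add_edge (h.adj v hvN.1).symm using 1
        abel
    convert hv.add hedges using 1
    · omega
    · abel

end SimpleGraph

/-! ### Lower bound for critical exponents -/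

namespace SimpleGraph

variable {V : Type*} {G : SimpleGraph V}

/-- On a chordless cycle minus its base vertex, edges join consecutive vertices only. -/
lemma Walk.IsCycle.eq_succ_of_mem_edges {v : V} {C : G.Walk v v} (hC : C.IsCycle) {i j : ℕ}
    (hj : 1 ≤ j) (hji : j ≤ i) (hi : i < C.length)
    (h : s(C.getVert j, C.getVert i) ∈ C.edges) : i = j + 1 := by
  obtain ⟨t, ht, hte⟩ := List.getElem_of_mem h
  rw [Walk.length_edges] at ht
  rw [Walk.getElem_edges] at hte
  have inj : ∀ a b, 1 ≤ a → a ≤ C.length → 1 ≤ b → b ≤ C.length →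
      C.getVert a = C.getVert b → a = b :=
    fun a b h1 h2 h3 h4 hab ↦ hC.getVert_injOn ⟨h1, h2⟩ ⟨h3, h4⟩ hab
  have inj0 : ∀ b, 1 ≤ b → b < C.length → C.getVert 0 ≠ C.getVert b := by
    intro b h1 h2 hb
    rw [Walk.getVert_zero] at hb
    have := inj _ _ (by omega) le_rfl h1 h2.le (C.getVert_length.trans hb)
    omega
  rcases Sym2.eq_iff.mp hte with ⟨h1, h2⟩ | ⟨h1, h2⟩
  · have h3 := inj _ _ (by omega) (by omega) (by omega) (by omega) h2
    rcases Nat.eq_zero_or_pos t with rfl | ht0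
    · exact absurd h1 (inj0 j hj (by omega))
    · have h4 := inj _ _ ht0 (by omega) hj (by omega) h1
      omega
  · have h3 := inj _ _ (by omega) (by omega) (by omega) (by omega) h2
    rcases Nat.eq_zero_or_pos t with rfl | ht0
    · exact absurd h1 (inj0 i (by omega) hi)
    · have h4 := inj _ _ ht0 (by omega) (by omega) (by omega) h1
      omega

/-- There are no critical exponents on a proper final segment of a chordless cycle. -/
lemma Walk.IsCycle.not_isCritical_segment {v : V} {C : G.Walk v v} (hC : C.IsCycle)
    (hchord : ∀ x y, G.Adj x y → x ∈ C.support → y ∈ C.support → s(x, y) ∈ C.edges)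
    (d : ℕ) {j n : ℕ} {a : V →₀ ℕ} (hj : 1 ≤ j) (hd : j + d + 1 = C.length) :
    ¬ G.IsCritical {x | ∃ i, j ≤ i ∧ i < C.length ∧ C.getVert i = x} n a := by
  have hedge : ∀ {j i : ℕ}, 1 ≤ j → j ≤ i → i < C.length →
      G.Adj (C.getVert j) (C.getVert i) → i = j + 1 := fun h1 h2 h3 hadj ↦
    hC.eq_succ_of_mem_edges h1 h2 h3
      (hchord _ _ hadj (C.getVert_mem_support _) (C.getVert_mem_support _))
  induction d generalizing j n a with
  | zero =>
    intro h
    obtain ⟨w, ⟨i, hi1, hi2, rfl⟩, hadj, -⟩ := h.exists_adj ⟨j, le_rfl, by omega, rfl⟩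
    have := hedge hj hi1 hi2 hadj
    omega
  | succ d ih =>
    intro h
    -- The first vertex of the segment is a leaf; pruning ends at a single vertex, which lacks the
    -- neighbour that criticality demands.
    obtain ⟨n', a', h', -⟩ := h.prune (l := C.getVert j) (u := C.getVert (j + 1))
      ⟨j, le_rfl, by omega, rfl⟩ (C.adj_getVert_succ (by omega)) (by
        rintro _ ⟨i, hi1, hi2, rfl⟩ hadj
        rw [hedge hj hi1 hi2 hadj])
    refine ih (j := j + 1) (by omega) (by omega) (n := n') (a := a') ?_
    convert h' using 1
    ext x
    constructor
    · rintro ⟨i, hi1, hi2, rfl⟩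
      refine ⟨⟨i, by omega, hi2, rfl⟩, fun hij ↦ ?_⟩
      have := hC.getVert_injOn (by simp only [Set.mem_ofPred_eq]; omega)
        (by simp only [Set.mem_ofPred_eq]; omega) hij
      omega
    · rintro ⟨⟨i, hi1, hi2, rfl⟩, hx⟩
      refine ⟨i, ?_, hi2, rfl⟩
      rcases hi1.eq_or_lt with rfl | h1
      · exact absurd rfl hx
      · exact h1

/-- If `a` vanished at `c`, it would be critical on the path left after removing `c`, which is
impossible. So `a` dominates the product of the cycle vertices, which already packs `m` edges. -/
lemma Walk.IsCycle.lt_of_isCritical {v : V} {C : G.Walk v v} (hC : C.IsCycle) {m : ℕ}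
    (hm : C.length = 2 * m + 1)
    (hchord : ∀ x y, G.Adj x y → x ∈ C.support → y ∈ C.support → s(x, y) ∈ C.edges)
    {n : ℕ} {a : V →₀ ℕ} (h : G.IsCritical {x | x ∈ C.support} n a) : m < n := by
  classical
  have hpos : ∀ c ∈ C.support, a c ≠ 0 := by
    intro c hc hac
    wlog hcv : c = v generalizing v C
    · refine this (hC.rotate hc) (by simpa using hm) (fun x y hxy hx hy ↦ ?_) (by simpa using h)
        (Walk.start_mem_support _) rfl
      rw [(C.rotate_edges c hc).mem_iff]
      exact hchord x y hxy (by simpa using hx) (by simpa using hy)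
    subst hcv
    have h3 := hC.three_le_length
    refine hC.not_isCritical_segment hchord (C.length - 2) (j := 1) (n := n) (a := a) le_rfl
      (by omega) ⟨fun x hx ↦ ?_, h.not_packs, ?_⟩
    · by_cases hxC : x ∈ C.support
      · obtain ⟨i, rfl, hi⟩ := Walk.mem_support_iff_exists_getVert.mp hxC
        by_cases hi0 : i = 0
        · rwa [hi0, Walk.getVert_zero]
        · by_cases hiL : i = C.length
          · rwa [hiL, Walk.getVert_length]
          · exact absurd ⟨i, by omega, by omega, rfl⟩ hx
      · exact h.eq_zero x hxC
    · rintro _ ⟨i, -, -, rfl⟩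
      exact h.packs _ (C.getVert_mem_support i)
  by_contra! hle
  obtain ⟨⟨b, hb, hbp⟩, -⟩ := hC.packs_of_odd hm C.start_mem_support
  refine h.not_packs ((hbp.mono fun x ↦ ?_).of_le hle)
  have h1 : b x ≤ (∑ y ∈ C.support.toFinset, single y 1 : V →₀ ℕ) x := by
    rw [hb]; simp
  refine h1.trans ?_
  rw [Finsupp.finsetSum_apply]
  simp only [Finsupp.single_apply, Finset.sum_ite_eq', List.mem_toFinset]
  split_ifs with hx
  · exact Nat.one_le_iff_ne_zero.mpr (hpos x hx)
  · exact Nat.zero_le _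

/-- Pruning the attached trees: a lower bound for the degree of critical exponents. -/
lemma IsParent.add_card_le_of_isCritical [DecidableEq V] {S : Set V} {p : V → V} {r : V → ℕ}
    (h : G.IsParent S p r) {m : ℕ} (hbase : ∀ n a, G.IsCritical S n a → m < n)
    (D : Finset V) (hDS : ∀ w ∈ D, w ∉ S) (hDp : ∀ w ∈ D, p w ∈ D ∨ p w ∈ S)
    {n : ℕ} {a : V →₀ ℕ} (ha : G.IsCritical (S ∪ D) n a) :
    m + 1 + (D.filter fun w ↦ a w ≠ 0 ∨ ∃ z ∈ D, p z = w).card ≤ n := by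
  induction hc : D.card generalizing D n a with
  | zero =>
    obtain rfl := Finset.card_eq_zero.mp hc
    simpa using hbase n a (by simpa using ha)
  | succ d ih =>
    -- A vertex of maximal rank has no child in `D`, so it is a leaf of the graph induced on `S ∪
    -- D`.
    obtain ⟨l, hl, hmax⟩ := D.exists_max_image r (Finset.card_pos.mp (by omega))
    have hlS := hDS l hl
    have hchild : ∀ z ∈ D, p z ≠ l := by
      rintro z hz rfl
      have := h.lt z (hDS z hz)
      have := hmax z hz
      omega
    have hpl : p l ≠ l := hchild l hl
    obtain ⟨n', a', ha', rfl, hu, heq⟩ := ha.prune (l := l) (u := p l) (Or.inr hl)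
      (h.adj l hlS) (by
        intro w hw hadj
        rcases h.eq_or_eq l w hadj (Or.inl hlS) with h1 | h1
        · exact h1.2.symm
        · rcases hw with hw | hw
          · exact absurd hw h1.1
          · exact absurd h1.2 (hchild w hw))
    have hset : (S ∪ D) \ {l} = S ∪ ((D.erase l : Finset V) : Set V) := by
      ext x
      simp only [Set.mem_sdiff, Set.mem_union, Finset.mem_coe, Set.mem_singleton_iff,
        Finset.mem_erase]
      constructor
      · rintro ⟨h1 | h1, h2⟩
        · exact Or.inl h1
        · exact Or.inr ⟨h2, h1⟩
      · rintro (h1 | ⟨h1, h2⟩)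
        · exact ⟨Or.inl h1, fun e ↦ hlS (e ▸ h1)⟩
        · exact ⟨Or.inr h2, h1⟩
    rw [hset] at ha'
    have key := ih (D.erase l) (fun w hw ↦ hDS w (Finset.mem_of_mem_erase hw)) (fun w hw ↦ by
      have hwD := Finset.mem_of_mem_erase hw
      rcases hDp w hwD with h1 | h1
      · exact Or.inl (Finset.mem_erase.mpr ⟨hchild w hwD, h1⟩)
      · exact Or.inr h1) ha' (by rw [Finset.card_erase_of_mem hl]; omega)
    set F' := (D.erase l).filter fun w ↦ a' w ≠ 0 ∨ ∃ z ∈ D.erase l, p z = w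
    -- The parent of `l` may lose its last child but stays counted because `a' (p l) ≠ 0`. Only `l`
    -- can drop out, and only if `a l ≥ 1`, which `n` pays for.
    have hsub : (D.filter fun w ↦ a w ≠ 0 ∨ ∃ z ∈ D, p z = w) ⊆
        F' ∪ if a l = 0 then ∅ else {l} := by
      intro w hw
      obtain ⟨hwD, hw⟩ := Finset.mem_filter.mp hw
      by_cases hwl : w = l
      · subst hwl
        rcases hw with hw | ⟨z, hz, hzw⟩
        · simp [hw]
        · exact absurd hzw (hchild z hz)
      · refine Finset.mem_union_left _ (Finset.mem_filter.mpr
          ⟨Finset.mem_erase.mpr ⟨hwl, hwD⟩, ?_⟩)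
        by_cases hwp : w = p l
        · exact Or.inl (hwp ▸ hu)
        · rcases hw with hw | ⟨z, hz, hzw⟩
          · exact Or.inl (by rwa [heq w hwl hwp])
          · refine Or.inr ⟨z, Finset.mem_erase.mpr ⟨?_, hz⟩, hzw⟩
            rintro rfl
            exact hwp hzw.symm
    have hcard := (Finset.card_le_card hsub).trans (Finset.card_union_le _ _)
    have hal : (if a l = 0 then ∅ else {l} : Finset V).card ≤ a l := by
      split_ifs with h0
      · simp
      · simpa using Nat.one_le_iff_ne_zero.mpr h0
    omega

end SimpleGraph

/-! ### The index of depth stability -/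

theorem lemmaT6 {V : Type*} [Fintype V] (K : Type*) [Field K] (G : SimpleGraph V)
    (hG : IsUnicyclic G) (hnb : ¬ G.IsBipartite) (k : ℕ) {v : V} (C : G.Walk v v)
    (hC : C.IsCycle) (hlen : C.length = 2 * k - 1) :
    (depthStableFrom (edgeIdeal K G)).Nonempty ∧
      (dstab (edgeIdeal K G) : ℤ) =
        (Fintype.card V : ℤ) - ((leafEdges G).ncard : ℤ) - (k : ℤ) + 1 := by
  classical
  -- A cycle has length at least `3`, so `k ≥ 1` and the subtraction in `2 * k - 1` is not
  -- truncated.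
  obtain ⟨m, rfl⟩ : ∃ m, k = m + 1 := ⟨k - 1, by have := hC.three_le_length; omega⟩
  have hm : C.length = 2 * m + 1 := by omega
  have hlen3 := hC.three_le_length
  obtain ⟨⟨p, r, hp⟩, hchord⟩ := SimpleGraph.exists_isParent_of_isUnicyclic hG hC
  set S : Set V := {w | w ∈ C.support} with hS
  have hSfin : S = C.support.toFinset := by ext; simp [hS]
  have hcount := SimpleGraph.ncard_leafEdges_add hp fun w hw ↦ by
    have h1 := hC.ncard_neighborSet_toSubgraph_eq_two hw
    have h2 := Set.ncard_le_ncard (C.toSubgraph.neighborSet_subset w) (Set.toFinite _)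
    omega
  have hScard : S.ncard = 2 * m + 1 := by
    rw [hSfin, Set.ncard_coe_finset, hC.card_support_toFinset, hm]
  set N := (SimpleGraph.innerVertices S p).ncard with hN
  have hzero : ∀ n, m + 1 + N ≤ n →
      polyDepth (V := V) (K := K) (MvPolynomial V K ⧸ edgeIdeal K G ^ n) = 0 := by
    intro n hn
    rw [polyDepth_edgeIdeal_pow_eq_zero_iff G (by omega)]
    refine hp.exists_isCritical (o := ∑ x ∈ C.support.toFinset, single x 1) (m := m)
      (fun c hc ↦ hC.packs_of_odd hm hc) ?_ (C.adj_getVert_succ (i := 0) (by omega)) hn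
    rw [map_sum]
    simp only [Finsupp.degree_single, Finset.sum_const, hC.card_support_toFinset, hm]
    simp
  have hpos : ∀ n, n ≠ 0 →
      polyDepth (V := V) (K := K) (MvPolynomial V K ⧸ edgeIdeal K G ^ n) = 0 →
        m + 1 + N ≤ n := by
    intro n hn h0
    obtain ⟨a, ha⟩ := (polyDepth_edgeIdeal_pow_eq_zero_iff G hn).mp h0
    have huniv : S ∪ (C.support.toFinsetᶜ : Finset V) = Set.univ := by
      rw [hSfin, Finset.coe_compl, Set.union_compl_self]
    rw [← huniv] at ha
    have key := hp.add_card_le_of_isCritical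
      (fun n a h ↦ hC.lt_of_isCritical hm hchord h) _ (fun w hw ↦ by simpa [hS] using hw)
      (fun w _ ↦ by
        by_cases hw : p w ∈ C.support
        · exact Or.inr hw
        · exact Or.inl (by simpa using hw)) ha
    refine le_trans (Nat.add_le_add_left ?_ _) key
    rw [hN, ← Set.ncard_coe_finset]
    refine Set.ncard_le_ncard ?_ (Set.toFinite _)
    rintro w ⟨hwS, z, hz, hzw⟩
    simp only [Finset.coe_filter, Set.mem_ofPred_eq]
    exact ⟨by simpa [hS] using hwS, Or.inr ⟨z, by simpa [hS] using hz, hzw⟩⟩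
  have hmem : m + 1 + N ∈ depthStableFrom (edgeIdeal K G) :=
    ⟨by omega, fun n hn ↦ by rw [hzero n hn, hzero _ le_rfl]⟩
  -- The stable value is zero, so the depth at any stable index is already zero.
  have hle : ∀ n ∈ depthStableFrom (edgeIdeal K G), m + 1 + N ≤ n := by
    rintro n ⟨h1, h2⟩
    by_contra! hlt
    have h3 := h2 (m + 1 + N) hlt.le
    rw [hzero _ le_rfl] at h3
    have := hpos n (by omega) h3.symm
    omega
  have hdstab : dstab (edgeIdeal K G) = m + 1 + N :=
    le_antisymm (Nat.sInf_le hmem) (hle _ (Nat.sInf_mem ⟨_, hmem⟩))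
  refine ⟨⟨_, hmem⟩, ?_⟩
  rw [hdstab]
  push_cast
  omega
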